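/- **Setting.** A *Borel space* is a Borel subset of a Polish space, with the relative topology and its Borel σ-algebra. A subset of a Borel space $X$ is *analytic* if it is empty or the image of a Borel subset of a Polish space under a Borel measurable map. The *universal σ-algebra* of $X$ is the intersection, over all Borel probability measures $p$ on $X$, of the σ-algebras of sets measurable for the completion of $p$. A function $f : D \to [-\infty,\infty]$ on a subset $D$ of a Borel space is *lower semi-analytic* if $D$ is analytic and $\{x \in D \mid f(x) < c\}$ is analytic for every real $c$; $A(D)$ denotes the set of such functions. Conventions: $\infty-\infty=-\infty+\infty=\infty$ and $0\cdot(\pm\infty)=0$; the integral of an extended real-valued function $f$ against a Borel probability measure $p$ is $\int f^+dp-\int f^-dp$, taken with respect to the completion of $p$. Let $S$ and $C$ be Borel spaces. For each $x\in S$ let $U(x)\subset C$ be nonempty, such that $\Gamma=\{(x,u)\mid x\in S,\ u\in U(x)\}$ is an analytic subset of $S\times C$. Let $g:\Gamma\to[-\infty,\infty]$ be lower semi-analytic, let $q(dx'\mid x,u)$ be a Borel measurable stochastic kernel on $S$ given $S\times C$, and let $\alpha\in[0,1]$. A *stationary policy* $\mu$ is a family $(\mu(du\mid x))_{x\in S}$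 of Borel probability measures on $C$ such that $x\mapsto\mu(D\mid x)$ is universally measurable for every Borel $D\subset C$ and $\mu(U(x)\mid x)=1$ for all $x\in S$ (with respect to the completion of $\mu(\cdot\mid x)$). Let $\Theta$ be the set of pairs $(\mu,B)$ of a stationary policy $\mu$ and a Borel set $B\subset S$ such that $x\mapsto\mu(D\mid x)$ is Borel measurable on $B$ for every Borel $D\subset C$. For $\theta=(\mu,B)\in\Theta$, $Q\in A(\Gamma)$ and $J\in A(S)$ set, for $(x,u)\in\Gamma$, $$F_\theta(Q;J)(x,u)=g(x,u)+\alpha\int_{S\setminus B}J(x')\,q(dx'\mid x,u)+\alpha\int_B\int_C\min\{J(x'),Q(x',u')\}\,\mu(du'\mid x')\,q(dx'\mid x,u),$$ where $Q$ is read as $\infty$ outside $\Gamma$. **Proposition 3.1.** (a) For every $\theta\in\Theta$ and every $J\in A(S)$, the map $F_\theta(\cdot\,;J)$ sends $A(\Gamma)$ into $A(\Gamma)$. (b) For every stationary policy $\mu$ and every Borel probability measure $p$ on $S$, there is a Borel set $B\subset S$ with $p(S\setminus B)=0$ and $(\mu,B)\in\Theta$. -/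

import Mathlib

open MeasureTheory ProbabilityTheory

/-! Borel spaces. A Borel space (a Borel subset of a Polish space with the relative topology and
the Borel σ-algebra) is a separable metrizable topological space whose Borel σ-algebra is standard;
it appears below as a type `X` with the instances `TopologicalSpace X`, `MetrizableSpace X`,
`SecondCountableTopology X`, `MeasurableSpace X`, `BorelSpace X`, `StandardBorelSpace X`.
Analytic sets are Mathlib's `MeasureTheory.AnalyticSet`: empty, or a continuous image of `ℕ → ℕ`. -/

namespace StochControl

universe u v

section General

variable {X : Type u}

/-- The universal σ-algebra: the sets that are measurable with respect to the completion of every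
Borel probability measure. -/
@[reducible] def universalSigma (X : Type u) [MeasurableSpace X] : MeasurableSpace X where
  MeasurableSet' s := ∀ p : Measure X, IsProbabilityMeasure p → NullMeasurableSet s p
  measurableSet_empty := fun _ _ => nullMeasurableSet_empty
  measurableSet_compl := fun _ hs p hp => (hs p hp).compl
  measurableSet_iUnion := fun _ hf p hp => NullMeasurableSet.iUnion fun i => hf i p hp

/-- A lower semi-analytic function on the whole Borel space `X`: all level sets `{f < c}` with
`c` real are analytic. (The domain `X` is a Borel space, hence analytic.) -/
def LowerSemianalytic [TopologicalSpace X] (f : X → EReal) : Prop :=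
  ∀ c : ℝ, AnalyticSet {x : X | f x < (c : EReal)}

/-- A lower semi-analytic function on a subset `D` of a Borel space `X`: the domain `D` is
analytic, and all level sets `{x ∈ D | f x < c}` with `c` real are analytic. -/
def LowerSemianalyticOn [TopologicalSpace X] (D : Set X) (f : D → EReal) : Prop :=
  AnalyticSet D ∧ ∀ c : ℝ, AnalyticSet {x : X | ∃ h : x ∈ D, f ⟨x, h⟩ < (c : EReal)}

open Classical in
/-- Addition of extended reals with the convention `∞ - ∞ = -∞ + ∞ = ∞`
(Mathlib's addition has `⊤ + ⊥ = ⊥`). -/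
noncomputable def addTop (a b : EReal) : EReal :=
  if a = ⊤ ∨ b = ⊤ then ⊤ else a + b

/-- The integral `∫ f dp = ∫ f⁺ dp - ∫ f⁻ dp` of an extended real-valued function with respect to
the completion of `p`, with the convention `∞ - ∞ = ∞`. -/
noncomputable def eIntegral [MeasurableSpace X] (p : Measure X) (f : X → EReal) : EReal :=
  addTop ((lintegral p.completion fun x => (f x).toENNReal : ENNReal) : EReal)
    (-((lintegral p.completion fun x => (-f x).toENNReal : ENNReal) : EReal))

open Classical in
/-- The extension by `∞` of a function defined on a subset. -/
noncomputable def extendTop {D : Set X} (Q : D → EReal) (x : X) : EReal :=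
  if h : x ∈ D then Q ⟨x, h⟩ else ⊤

end General

/-- The stochastic control model with state space `S` and control space `C`. -/
structure ControlModel (S : Type u) (C : Type v) [TopologicalSpace S] [MeasurableSpace S]
    [TopologicalSpace C] [MeasurableSpace C] where
  /-- the control constraint `x ↦ U(x)` -/
  U : S → Set C
  U_nonempty : ∀ x, (U x).Nonempty
  /-- the graph `Γ` of `U` is analytic -/
  analytic_graph : AnalyticSet {z : S × C | z.2 ∈ U z.1}
  /-- the one-stage cost `g : Γ → [-∞, ∞]` -/
  g : {z : S × C | z.2 ∈ U z.1} → EReal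
  g_lsa : LowerSemianalyticOn {z : S × C | z.2 ∈ U z.1} g
  /-- the Borel measurable state transition kernel `q(dx' | x, u)` -/
  q : Kernel (S × C) S
  q_prob : ∀ z, IsProbabilityMeasure (q z)
  /-- the discount factor -/
  α : ℝ
  α_nonneg : 0 ≤ α
  α_le_one : α ≤ 1

section Model

variable {S : Type u} {C : Type v} [TopologicalSpace S] [MeasurableSpace S]
  [TopologicalSpace C] [MeasurableSpace C]

/-- The graph `Γ` of the control constraint. -/
def ControlModel.Γ (M : ControlModel S C) : Set (S × C) := {z | z.2 ∈ M.U z.1}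

/-- A (universally measurable, possibly randomized) stationary policy: a universally measurable
stochastic kernel on `C` given `S` that satisfies the control constraint `μ(U(x) | x) = 1`.
(A measure in Mathlib is evaluated on every set through its outer measure, which on the
universally measurable set `U(x)` is the value of the completion.) -/
structure StationaryPolicy (M : ControlModel S C) where
  /-- the kernel `x ↦ μ(du | x)` -/
  toFun : S → Measure C
  prob : ∀ x, IsProbabilityMeasure (toFun x)
  univ_meas : ∀ D : Set C, MeasurableSet D →
    @Measurable S ENNReal (universalSigma S) _ fun x => toFun x D
  constraint : ∀ x, toFun x (M.U x) = 1

/-- The set `Θ` of pairs `(μ, B)` of a stationary policy and a Borel subset of `S` such that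
the restriction of `x ↦ μ(du | x)` to `B` is a Borel measurable stochastic kernel. -/
def Theta (M : ControlModel S C) : Set (StationaryPolicy M × Set S) :=
  {θ | MeasurableSet θ.2 ∧
    ∀ D : Set C, MeasurableSet D → Measurable fun x : θ.2 => θ.1.toFun (x : S) D}

/-- The mapping `F_θ(Q; J)(x, u) = g(x, u) + α ∫_{S∖B} J(x') q(dx' | x, u)
 + α ∫_B ∫_C min {J(x'), Q(x', u')} μ(du' | x') q(dx' | x, u)` for `(x, u) ∈ Γ`, where
`θ = (μ, B)` and `Q` is read as `∞` outside `Γ`. -/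
noncomputable def F (M : ControlModel S C) (θ : StationaryPolicy M × Set S)
    (Q : M.Γ → EReal) (J : S → EReal) : M.Γ → EReal := fun z =>
  addTop
    (addTop (M.g z)
      ((M.α : EReal) * eIntegral (M.q z) (Set.indicator (θ.2)ᶜ J)))
    ((M.α : EReal) * eIntegral (M.q z) (Set.indicator θ.2 fun x' =>
      eIntegral (θ.1.toFun x') fun u' => min (J x') (extendTop Q (x', u'))))

end Model

end StochControl

/-!
The assertion about `F` is the fact that integrating a lower semi-analytic function against a Borel
measurable kernel gives a lower semi-analytic function (`LowerSemianalytic.eIntegral_kernel`),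
together with the stability of lower semi-analytic functions under sums (with `∞ - ∞ = ∞`),
nonnegative multiples, minima and gluing along Borel sets. On `B` the policy is Borel measurable, so
it agrees there with a Borel measurable Markov kernel, to which that fact applies.

The fact about integrals rests on the case of indicator functions (`analyticSet_lt_kernel`): for an
analytic `A ⊆ X × Y` and a finite Borel kernel `κ`, the set `{x | r < κ x A_x}` is analytic. This is
proved without spaces of measures and without measurable selection. Let `A` be the range of a
continuous `f` on `ℕ → ℕ`, and for `σ : ℕ → ℕ` let `boxHull f σ` be the intersection over `k` of
the closures of `f '' {τ | τ ≤ σ on {0, …, k - 1}}`. By compactness of `{τ | τ ≤ σ}` this set is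
contained in `A`, and the capacity argument of Choquet shows that the mass `r < κ x A_x` is already
exceeded by `boxHull f σ` for some `σ`. Since `boxHull f σ` depends on `σ` in a Borel way,
`{(x, σ) | r < κ x (boxHull f σ)_x}` is Borel, and `{x | r < κ x A_x}` is its projection. The same
approximation shows that analytic sets are universally measurable.

From sets to functions one passes through the formula
`∫ f dp = sup_n (1 / n) ∑_{k ≥ 1} p {f > k / n}` (`lintegral_completion_eq_iSup_tsum`), applied to
the positive part, where the sets `{f > t}` are complements of analytic sets, and to the negative
part, where they are analytic.

The existence of `B` follows from countable generation of the Borel sets of `C`: each of the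
countably many functions `x ↦ μ(D | x)`, with `D` in a countable generating algebra, is equal
`p`-almost everywhere to a Borel function, and a monotone class argument handles the other `D`.
-/

open Set Filter Topology

namespace StochControl

/-! ### Analytic subsets of Borel spaces -/

theorem analyticSet_projection {X : Type*} [TopologicalSpace X] [SecondCountableTopology X]
    [MeasurableSpace X] [BorelSpace X] [StandardBorelSpace X] {E : Set (X × (ℕ → ℕ))}
    (hE : MeasurableSet E) : AnalyticSet {x | ∃ σ, (x, σ) ∈ E} := by
  have h : {x | ∃ σ, (x, σ) ∈ E} = Prod.fst '' E := by
    ext x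
    simp
  rw [h]
  exact hE.analyticSet_image measurable_fst

theorem analyticSet_of_measurableSet {X : Type*} [TopologicalSpace X] [SecondCountableTopology X]
    [MeasurableSpace X] [BorelSpace X] [StandardBorelSpace X] {E : Set X}
    (hE : MeasurableSet E) : AnalyticSet E := by
  simpa using hE.analyticSet_image measurable_id

/-- Unlike in `AnalyticSet.preimage`, the domain need not be Polish: it is a Borel space. -/
theorem _root_.MeasureTheory.AnalyticSet.preimage_of_continuous {X Y : Type*}
    [TopologicalSpace X] [SecondCountableTopology X]
    [MeasurableSpace X] [BorelSpace X] [StandardBorelSpace X] [TopologicalSpace Y] [T2Space Y]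
    [SecondCountableTopology Y]
    {A : Set Y} (hA : AnalyticSet A) {f : X → Y} (hf : Continuous f) :
    AnalyticSet (f ⁻¹' A) := by
  rw [AnalyticSet] at hA
  obtain rfl | ⟨g, hg, rfl⟩ := hA
  · simpa using analyticSet_empty
  · have hE : IsClosed {z : X × (ℕ → ℕ) | g z.2 = f z.1} :=
      isClosed_eq (hg.comp continuous_snd) (hf.comp continuous_fst)
    exact analyticSet_projection hE.measurableSet

/-! ### Approximation of analytic sets from inside -/

/-- An envelope of the set `f '' {τ | τ ≤ σ}` that visibly depends on `σ` in a Borel way, and is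
equal to that set if `f` is continuous with values in a metrizable space: the intersection over `k`
of the closures of the images of the sets of all `τ` that are bounded by `σ` at the first `k`
places. -/
def boxHull {Z : Type*} [TopologicalSpace Z] (f : (ℕ → ℕ) → Z) (σ : ℕ → ℕ) : Set Z :=
  ⋂ k, closure (f '' {τ | ∀ i < k, τ i ≤ σ i})

/-- If `z` is the limit of `f (τ k)` with `τ k ≤ σ` at the first `k` places, then the truncations of
`τ k` at `σ` have a convergent subsequence, and along it `τ k` converges to the same limit. -/
theorem boxHull_subset_range {Z : Type*} [TopologicalSpace Z] [T2Space Z]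
    [FirstCountableTopology Z] {f : (ℕ → ℕ) → Z} (hf : Continuous f) (σ : ℕ → ℕ) :
    boxHull f σ ⊆ range f := by
  intro z hz
  obtain ⟨V, hV⟩ := (𝓝 z).exists_antitone_basis
  have h1 : ∀ k, ∃ τ : ℕ → ℕ, (∀ i < k, τ i ≤ σ i) ∧ f τ ∈ V k := by
    intro k
    have hk := mem_iInter.1 hz k
    obtain ⟨_, hV', τ, hτ, rfl⟩ := mem_closure_iff_nhds.1 hk (V k) (hV.toHasBasis.mem_of_mem trivial)
    exact ⟨τ, hτ, hV'⟩
  choose τ hτ hτV using h1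
  have hlim : Tendsto (fun k => f (τ k)) atTop (𝓝 z) := hV.tendsto hτV
  have hT : IsCompact (Set.pi univ fun i => Iic (σ i)) :=
    isCompact_univ_pi fun i => (finite_Iic (σ i)).isCompact
  obtain ⟨ρ, -, φ, hφ, hρ⟩ := hT.tendsto_subseq (x := fun k i => min (τ k i) (σ i))
    (fun k i _ => mem_Iic.2 (min_le_right _ _))
  have hτρ : Tendsto (fun k => τ (φ k)) atTop (𝓝 ρ) := by
    rw [tendsto_pi_nhds] at hρ ⊢
    intro i
    refine (hρ i).congr' ?_
    filter_upwards [eventually_gt_atTop i] with k hk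
    exact min_eq_left (hτ _ i (hk.trans_le (hφ.id_le k)))
  exact ⟨ρ, tendsto_nhds_unique ((hf.tendsto ρ).comp hτρ) (hlim.comp hφ.tendsto_atTop)⟩

theorem measurableSet_boxHull {Z : Type*} [TopologicalSpace Z] [MeasurableSpace Z]
    [OpensMeasurableSpace Z] (f : (ℕ → ℕ) → Z) :
    MeasurableSet {w : Z × (ℕ → ℕ) | w.1 ∈ boxHull f w.2} := by
  have h : {w : Z × (ℕ → ℕ) | w.1 ∈ boxHull f w.2} =
      ⋂ k : ℕ, ⋃ s : Fin k → ℕ, closure (f '' {τ | ∀ i : Fin k, τ i ≤ s i}) ×ˢ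
        {σ : ℕ → ℕ | ∀ i : Fin k, σ i = s i} := by
    ext ⟨z, σ⟩
    simp only [boxHull, mem_ofPred_eq, mem_iInter, mem_iUnion, mem_prod]
    refine forall_congr' fun k => ⟨fun h => ⟨fun i => σ i, ?_, fun _ => rfl⟩, ?_⟩
    · convert! h using 5 with τ
      exact ⟨fun h i hi => h ⟨i, hi⟩, fun h i => h i i.2⟩
    · rintro ⟨s, h, hs⟩
      convert! h using 5 with τ
      exact ⟨fun h i => hs i ▸ h i i.2, fun h i hi => (h ⟨i, hi⟩).trans_eq (hs ⟨i, hi⟩).symm⟩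
  rw [h]
  refine MeasurableSet.iInter fun k => MeasurableSet.iUnion fun s => ?_
  refine isClosed_closure.measurableSet.prod ?_
  rw [ofPred_forall]
  exact MeasurableSet.iInter fun i => measurable_pi_apply _ (measurableSet_singleton _)

/-- The capacity argument: the numbers `σ k` are chosen one after the other, by continuity of (outer)
measures along increasing unions, so that the images of the boxes keep a mass above a fixed number;
continuity along decreasing intersections of closed sets then gives the bound for the hull. The map
`e` serves for passing to sections. -/
theorem exists_lt_measure_preimage_boxHull {Y Z : Type*} [TopologicalSpace Y] [MeasurableSpace Y]
    [OpensMeasurableSpace Y] [TopologicalSpace Z] {e : Y → Z} (he : Continuous e)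
    (p : Measure Y) [IsFiniteMeasure p] (f : (ℕ → ℕ) → Z) {r : ENNReal}
    (hr : r < p (e ⁻¹' range f)) : ∃ σ, r < p (e ⁻¹' boxHull f σ) := by
  obtain ⟨r', hrr', hr'⟩ := exists_between hr
  let N : (ℕ → ℕ) → ℕ → Set (ℕ → ℕ) := fun s k => {τ | ∀ i < k, τ i ≤ s i}
  -- Changing the bound at place `k` to a large `n` costs little mass.
  have hstep : ∀ (s : ℕ → ℕ) (k : ℕ), ∃ n, r' < p (e ⁻¹' (f '' N s k)) →
      r' < p (e ⁻¹' (f '' N (Function.update s k n) (k + 1))) := by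
    intro s k
    by_cases h : r' < p (e ⁻¹' (f '' N s k))
    · have hU : N s k = ⋃ n, N (Function.update s k n) (k + 1) := by
        ext τ
        simp only [N, mem_ofPred_eq, mem_iUnion]
        constructor
        · intro h
          refine ⟨τ k, fun i hi => ?_⟩
          rcases Nat.lt_succ_iff_lt_or_eq.1 hi with hi | rfl
          · simpa [hi.ne] using h i hi
          · simp
        · rintro ⟨n, hn⟩ i hi
          simpa [hi.ne] using hn i (hi.trans k.lt_succ_self)
      have hm : Monotone fun n => e ⁻¹' (f '' N (Function.update s k n) (k + 1)) := by
        intro m n hmn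
        refine preimage_mono (image_mono fun τ hτ i hi => (hτ i hi).trans ?_)
        by_cases hik : i = k
        · subst hik; simpa using hmn
        · simp [hik]
      rw [hU, image_iUnion, preimage_iUnion, hm.measure_iUnion, lt_iSup_iff] at h
      obtain ⟨n, hn⟩ := h
      exact ⟨n, fun _ => hn⟩
    · exact ⟨0, fun h' => (h h').elim⟩
  choose next hnext using hstep
  let seq : ℕ → ℕ → ℕ := fun k => Nat.rec 0 (fun k s => Function.update s k (next s k)) k
  have hseq : ∀ k, seq (k + 1) = Function.update (seq k) k (next (seq k) k) := fun k => rfl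
  have hpos : ∀ k, r' < p (e ⁻¹' (f '' N (seq k) k)) := by
    intro k
    induction k with
    | zero =>
      have : N (seq 0) 0 = univ := by
        ext τ
        simp [N]
      rwa [this, image_univ]
    | succ k ih => exact hnext _ _ ih
  -- The place `i` of `seq` does not change any more after step `i + 1`.
  let σ : ℕ → ℕ := fun i => seq (i + 1) i
  have hσ : ∀ i k, i < k → seq k i = σ i := by
    intro i k hik
    induction k, hik using Nat.le_induction with
    | base => rfl
    | succ k hk ih => rw [hseq, Function.update_of_ne (by omega), ih]
  have hNσ : ∀ k, N (seq k) k = N σ k := by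
    intro k
    ext τ
    exact forall₂_congr fun i hi => by rw [hσ i k hi]
  refine ⟨σ, hrr'.trans_le ?_⟩
  have hanti : Antitone fun k => e ⁻¹' closure (f '' N σ k) := fun m n hmn =>
    preimage_mono (closure_mono (image_mono fun τ hτ i hi => hτ i (hi.trans_le hmn)))
  rw [boxHull, preimage_iInter, hanti.measure_iInter
    (fun k => (isClosed_closure.preimage he).measurableSet.nullMeasurableSet)
    ⟨0, measure_ne_top _ _⟩]
  refine le_iInf fun k => (hpos k).le.trans ?_
  rw [hNσ]
  exact measure_mono (preimage_mono subset_closure)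

/-- Analytic sets are universally measurable. -/
theorem _root_.MeasureTheory.AnalyticSet.nullMeasurableSet {Y : Type*} [TopologicalSpace Y]
    [T2Space Y] [FirstCountableTopology Y] [MeasurableSpace Y] [OpensMeasurableSpace Y] {A : Set Y}
    (hA : AnalyticSet A) (p : Measure Y) [IsFiniteMeasure p] : NullMeasurableSet A p := by
  rw [AnalyticSet] at hA
  obtain rfl | ⟨f, hf, rfl⟩ := hA
  · exact nullMeasurableSet_empty
  have hmeas : ∀ σ, MeasurableSet (boxHull f σ) := fun σ =>
    MeasurableSet.iInter fun k => isClosed_closure.measurableSet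
  by_cases h0 : p (range f) = 0
  · exact NullMeasurableSet.of_null h0
  obtain ⟨u, -, hu, hlim⟩ := exists_seq_strictMono_tendsto' (pos_iff_ne_zero.2 h0)
  choose σ hσ using fun n =>
    exists_lt_measure_preimage_boxHull continuous_id p f (r := u n) (hu n).2
  have hsub : (⋃ n, boxHull f (σ n)) ⊆ range f :=
    iUnion_subset fun n => boxHull_subset_range hf _
  have hle : p (range f) ≤ p (⋃ n, boxHull f (σ n)) :=
    le_of_tendsto' hlim fun n => (hσ n).le.trans
      (measure_mono (subset_iUnion (fun n => boxHull f (σ n)) n))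
  have hM : MeasurableSet (⋃ n, boxHull f (σ n)) := MeasurableSet.iUnion fun n => hmeas _
  refine ⟨_, hM, ?_⟩
  refine (ae_eq_of_subset_of_measure_ge hsub hle hM.nullMeasurableSet (measure_ne_top _ _)).symm

/-- For a Borel kernel, the measure of the sections of an analytic set is upper semi-analytic. -/
theorem analyticSet_lt_kernel {X Y : Type*}
    [TopologicalSpace X] [T2Space X] [SecondCountableTopology X]
    [MeasurableSpace X] [BorelSpace X] [StandardBorelSpace X]
    [TopologicalSpace Y] [T2Space Y] [SecondCountableTopology Y]
    [MeasurableSpace Y] [BorelSpace Y]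
    (κ : Kernel X Y) [IsFiniteKernel κ] {A : Set (X × Y)} (hA : AnalyticSet A) (r : ENNReal) :
    AnalyticSet {x | r < κ x (Prod.mk x ⁻¹' A)} := by
  rw [AnalyticSet] at hA
  obtain rfl | ⟨f, hf, rfl⟩ := hA
  · simpa using analyticSet_empty
  have h : {x | r < κ x (Prod.mk x ⁻¹' range f)} =
      {x | ∃ σ, (x, σ) ∈ {w : X × (ℕ → ℕ) | r < κ w.1 (Prod.mk w.1 ⁻¹' boxHull f w.2)}} := by
    ext x
    refine ⟨fun h => exists_lt_measure_preimage_boxHull (by fun_prop) _ f h, ?_⟩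
    rintro ⟨σ, hσ⟩
    exact lt_of_lt_of_le hσ (measure_mono (preimage_mono (boxHull_subset_range hf σ)))
  rw [h]
  refine analyticSet_projection (measurableSet_lt measurable_const ?_)
  have hm : MeasurableSet {w : (X × (ℕ → ℕ)) × Y | (w.1.1, w.2) ∈ boxHull f w.1.2} :=
    (measurable_fst.fst.prodMk measurable_snd).prodMk measurable_fst.snd
      (measurableSet_boxHull f)
  exact Kernel.measurable_kernel_prodMk_left (κ := κ.comap Prod.fst measurable_fst) hm

/-! ### Integrals as suprema of sums over level sets -/

/-- The number of integers `k ≥ 1` with `k < a` differs from `a` by at most `1`. -/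
theorem tsum_indicator_add_one_lt_bounds (a : ENNReal) :
    (∑' k : ℕ, {b : ENNReal | (k : ENNReal) + 1 < b}.indicator 1 a) ≤ a ∧
      a ≤ (∑' k : ℕ, {b : ENNReal | (k : ENNReal) + 1 < b}.indicator 1 a) + 1 := by
  by_cases ha : a = ⊤
  · subst ha
    have h : ∀ k : ℕ, {b : ENNReal | (k : ENNReal) + 1 < b}.indicator 1 (⊤ : ENNReal) =
        (1 : ENNReal) := fun k =>
      indicator_of_mem (s := {b : ENNReal | (k : ENNReal) + 1 < b})
        (ENNReal.add_lt_top.2 ⟨ENNReal.natCast_lt_top k, ENNReal.one_lt_top⟩) 1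
    simp
  lift a to NNReal using ha
  have h : ∀ k : ℕ, {b : ENNReal | (k : ENNReal) + 1 < b}.indicator 1 (a : ENNReal) =
      if k ∈ Finset.range (⌈a⌉₊ - 1) then (1 : ENNReal) else 0 := by
    intro k
    rw [indicator_apply]
    refine if_congr ?_ rfl rfl
    have h1 : ((k : ENNReal) + 1 < a) ↔ k + 1 < ⌈a⌉₊ := by
      rw [Nat.lt_ceil]
      exact_mod_cast Iff.rfl
    rw [mem_ofPred_eq, h1, Finset.mem_range]
    omega
  have hs : (∑' k : ℕ, {b : ENNReal | (k : ENNReal) + 1 < b}.indicator 1 (a : ENNReal)) =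
      ((⌈a⌉₊ - 1 : ℕ) : ENNReal) := by
    rw [tsum_congr h, tsum_eq_sum (s := Finset.range (⌈a⌉₊ - 1)) (by intro b hb; rw [if_neg hb]),
      Finset.sum_ite_mem, Finset.inter_self, Finset.sum_const, Finset.card_range, nsmul_one]
  rw [hs]
  constructor
  · rcases Nat.eq_zero_or_pos ⌈a⌉₊ with h0 | h0
    · simp [h0]
    · have : ((⌈a⌉₊ - 1 : ℕ) : NNReal) < a := Nat.lt_ceil.1 (by omega)
      exact_mod_cast this.le
  · have h2 : a ≤ ((⌈a⌉₊ - 1 : ℕ) : NNReal) + 1 := by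
      refine (Nat.le_ceil a).trans ?_
      norm_cast
      omega
    exact_mod_cast h2

/-- For each `n` the sum on the right is the integral of a function that differs from `f` by at most
`1 / (n + 1)`. -/
theorem lintegral_eq_iSup_tsum {Y : Type*} [MeasurableSpace Y] (p : Measure Y)
    [IsProbabilityMeasure p] {f : Y → ENNReal}
    (hf : ∀ t, MeasurableSet {y | t < f y}) :
    lintegral p f =
      ⨆ n : ℕ, ((n + 1 : ℕ) : ENNReal)⁻¹ *
        ∑' k : ℕ, p {y | ((k : ENNReal) + 1) / ((n + 1 : ℕ) : ENNReal) < f y} := by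
  have hn0 : ∀ n : ℕ, ((n + 1 : ℕ) : ENNReal) ≠ 0 := fun n => by simp
  have hnt : ∀ n : ℕ, ((n + 1 : ℕ) : ENNReal) ≠ ⊤ := fun n => ENNReal.natCast_ne_top _
  have hset : ∀ n k : ℕ, {y | ((k : ENNReal) + 1) / ((n + 1 : ℕ) : ENNReal) < f y} =
      {y | (k : ENNReal) + 1 < ((n + 1 : ℕ) : ENNReal) * f y} := by
    intro n k
    ext y
    simp only [mem_ofPred_eq]
    rw [ENNReal.div_lt_iff (Or.inl (hn0 n)) (Or.inl (hnt n)), mul_comm]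
  have hint : ∀ n : ℕ,
      ∑' k : ℕ, p {y | ((k : ENNReal) + 1) / ((n + 1 : ℕ) : ENNReal) < f y} =
      lintegral p fun y => ∑' k : ℕ,
        {b : ENNReal | (k : ENNReal) + 1 < b}.indicator 1 (((n + 1 : ℕ) : ENNReal) * f y) := by
    intro n
    have hm : ∀ k : ℕ, MeasurableSet
        {y | ((k : ENNReal) + 1) / ((n + 1 : ℕ) : ENNReal) < f y} := fun k => hf _
    have hind : ∀ k : ℕ, (fun y => {b : ENNReal | (k : ENNReal) + 1 < b}.indicator 1
        (((n + 1 : ℕ) : ENNReal) * f y)) =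
        {y | ((k : ENNReal) + 1) / ((n + 1 : ℕ) : ENNReal) < f y}.indicator
          (1 : Y → ENNReal) := by
      intro k
      rw [hset]
      rfl
    rw [lintegral_tsum fun k => by
      rw [hind]
      exact (measurable_one.indicator (hm k)).aemeasurable]
    refine tsum_congr fun k => ?_
    rw [hind]
    exact (lintegral_indicator_one (hm k)).symm
  have hmul : ∀ n : ℕ, (lintegral p fun y => ((n + 1 : ℕ) : ENNReal) * f y) =
      ((n + 1 : ℕ) : ENNReal) * lintegral p f := fun n =>
    lintegral_const_mul' _ _ (hnt n)
  have hone : p univ = 1 := measure_univ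
  apply le_antisymm
  · have hlim : Tendsto (fun n : ℕ => (⨆ n : ℕ, ((n + 1 : ℕ) : ENNReal)⁻¹ *
        ∑' k : ℕ, p {y | ((k : ENNReal) + 1) / ((n + 1 : ℕ) : ENNReal) < f y}) +
        ((n + 1 : ℕ) : ENNReal)⁻¹) atTop (𝓝 ((⨆ n : ℕ, ((n + 1 : ℕ) : ENNReal)⁻¹ *
        ∑' k : ℕ, p {y | ((k : ENNReal) + 1) / ((n + 1 : ℕ) : ENNReal) < f y}) + 0)) :=
      tendsto_const_nhds.add
        (ENNReal.tendsto_inv_nat_nhds_zero.comp (tendsto_add_atTop_nat 1))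
    rw [add_zero] at hlim
    refine ge_of_tendsto' hlim fun n => ?_
    have h1 : ((n + 1 : ℕ) : ENNReal) * lintegral p f ≤
        ∑' k : ℕ, p {y | ((k : ENNReal) + 1) / ((n + 1 : ℕ) : ENNReal) < f y} + 1 := by
      rw [← hmul, hint]
      refine (lintegral_mono fun y => (tsum_indicator_add_one_lt_bounds _).2).trans ?_
      rw [lintegral_add_right _ measurable_const]
      simp [hone]
    have h2 : lintegral p f ≤ ((n + 1 : ℕ) : ENNReal)⁻¹ *
        (∑' k : ℕ, p {y | ((k : ENNReal) + 1) / ((n + 1 : ℕ) : ENNReal) < f y} + 1) := by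
      rw [mul_comm, ← div_eq_mul_inv, ENNReal.le_div_iff_mul_le (Or.inl (hn0 n)) (Or.inl (hnt n)),
        mul_comm]
      exact h1
    rw [mul_add, mul_one] at h2
    exact h2.trans (add_le_add_left (le_iSup (fun n : ℕ => ((n + 1 : ℕ) : ENNReal)⁻¹ *
        ∑' k : ℕ, p {y | ((k : ENNReal) + 1) / ((n + 1 : ℕ) : ENNReal) < f y}) n) _)
  · refine iSup_le fun n => ?_
    rw [mul_comm, ← div_eq_mul_inv]
    refine ENNReal.div_le_of_le_mul' ?_
    rw [hint, ← hmul]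
    exact lintegral_mono fun y => (tsum_indicator_add_one_lt_bounds _).1

/-- The form of `lintegral_eq_iSup_tsum` for functions that are measurable with respect to the
completion of `p`. -/
theorem lintegral_completion_eq_iSup_tsum {Y : Type*} [MeasurableSpace Y] (p : Measure Y)
    [IsProbabilityMeasure p] {f : Y → ENNReal}
    (hf : ∀ t, NullMeasurableSet {y | t < f y} p) :
    lintegral p.completion f =
      ⨆ n : ℕ, ((n + 1 : ℕ) : ENNReal)⁻¹ *
        ∑' k : ℕ, p {y | ((k : ENNReal) + 1) / ((n + 1 : ℕ) : ENNReal) < f y} := by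
  have : IsProbabilityMeasure p.completion := ⟨measure_univ (μ := p)⟩
  exact lintegral_eq_iSup_tsum (Y := NullMeasurableSpace Y p) p.completion hf

/-! ### Analytic level sets of functions with values in `[0, ∞]` -/

/-- Upper semi-analyticity of a function with values in `[0, ∞]`: the sets `{r < φ}` are
analytic. -/
def UpperSemianalyticENN {X : Type*} [TopologicalSpace X] (φ : X → ENNReal) : Prop :=
  ∀ r, AnalyticSet {x | r < φ x}

/-- Lower semi-analyticity of a function with values in `[0, ∞]`: the sets `{φ < r}` are
analytic. -/
def LowerSemianalyticENN {X : Type*} [TopologicalSpace X] (φ : X → ENNReal) : Prop :=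
  ∀ r, AnalyticSet {x | φ x < r}

section Analytic

variable {X : Type*} [TopologicalSpace X]

theorem _root_.MeasureTheory.AnalyticSet.union {A B : Set X} (hA : AnalyticSet A)
    (hB : AnalyticSet B) : AnalyticSet (A ∪ B) := by
  rw [union_eq_iUnion]
  exact AnalyticSet.iUnion fun b => by cases b <;> assumption

theorem _root_.MeasureTheory.AnalyticSet.inter [T2Space X] {A B : Set X} (hA : AnalyticSet A)
    (hB : AnalyticSet B) : AnalyticSet (A ∩ B) := by
  rw [inter_eq_iInter]
  exact AnalyticSet.iInter fun b => by cases b <;> assumption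

theorem analyticSet_iUnion_prop {P : Prop} {A : P → Set X} (hA : ∀ h, AnalyticSet (A h)) :
    AnalyticSet (⋃ h, A h) := by
  by_cases h : P
  · simpa [h] using hA h
  · simpa [h] using analyticSet_empty

theorem UpperSemianalyticENN.iSup {φ : ℕ → X → ENNReal} (h : ∀ n, UpperSemianalyticENN (φ n)) :
    UpperSemianalyticENN fun x => ⨆ n, φ n x := by
  intro r
  have : {x | r < ⨆ n, φ n x} = ⋃ n, {x | r < φ n x} := by
    ext x
    simp [lt_iSup_iff]
  rw [this]
  exact AnalyticSet.iUnion fun n => h n r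

theorem UpperSemianalyticENN.const_mul {φ : X → ENNReal} (h : UpperSemianalyticENN φ) {a : ENNReal}
    (ha0 : a ≠ 0) (ha : a ≠ ⊤) : UpperSemianalyticENN fun x => a * φ x := by
  intro r
  simpa only [ENNReal.div_lt_iff (Or.inl ha0) (Or.inl ha), mul_comm] using h (r / a)

theorem UpperSemianalyticENN.add [T2Space X] {φ ψ : X → ENNReal} (hφ : UpperSemianalyticENN φ)
    (hψ : UpperSemianalyticENN ψ) : UpperSemianalyticENN fun x => φ x + ψ x := by
  intro r
  -- If `φ x ≤ r` and `ψ x ≤ r`, then any `q` strictly between `r - ψ x` and `φ x` will do; the first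
  -- two sets cover the cases in which this fails because the subtraction truncates.
  have : {x | r < φ x + ψ x} = ({x | r < φ x} ∪ {x | r < ψ x}) ∪
      ⋃ q : ℚ, ⋃ _ : ((Real.toNNReal q : NNReal) : ENNReal) ≤ r,
        {x | ((Real.toNNReal q : NNReal) : ENNReal) < φ x} ∩
          {x | r - ((Real.toNNReal q : NNReal) : ENNReal) < ψ x} := by
    ext x
    simp only [mem_ofPred_eq, mem_union, mem_iUnion, mem_inter_iff, exists_prop]
    constructor
    · intro h
      by_cases h1 : r < φ x
      · exact Or.inl (Or.inl h1)
      by_cases h2 : r < ψ x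
      · exact Or.inl (Or.inr h2)
      rw [not_lt] at h1 h2
      have hψt : ψ x ≠ ⊤ := ne_top_of_le_ne_top (ne_top_of_lt h) h2
      obtain ⟨q, -, hq1, hq2⟩ := ENNReal.lt_iff_exists_rat_btwn.1
        ((ENNReal.sub_lt_iff_lt_right hψt h2).2 h)
      have hqr := hq2.le.trans h1
      refine Or.inr ⟨q, hqr, hq2, ?_⟩
      rw [ENNReal.sub_lt_iff_lt_right ENNReal.coe_ne_top hqr, add_comm]
      exact (ENNReal.sub_lt_iff_lt_right hψt h2).1 hq1
    · rintro ((h | h) | ⟨q, hqr, hq1, hq2⟩)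
      · exact h.trans_le le_self_add
      · exact h.trans_le le_add_self
      · rw [ENNReal.sub_lt_iff_lt_right ENNReal.coe_ne_top hqr] at hq2
        rw [add_comm]
        exact hq2.trans_le (add_le_add_right hq1.le _)
  rw [this]
  refine ((hφ r).union (hψ r)).union ?_
  refine AnalyticSet.iUnion fun q => ?_
  exact analyticSet_iUnion_prop fun _ => (hφ _).inter (hψ _)

theorem UpperSemianalyticENN.tsum [T2Space X] {φ : ℕ → X → ENNReal}
    (h : ∀ n, UpperSemianalyticENN (φ n)) : UpperSemianalyticENN fun x => ∑' n, φ n x := by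
  simp only [ENNReal.tsum_eq_iSup_nat]
  refine UpperSemianalyticENN.iSup fun n => ?_
  induction n with
  | zero =>
    intro r
    simpa using analyticSet_empty
  | succ n ih =>
    simp only [Finset.sum_range_succ]
    exact ih.add (h n)

theorem LowerSemianalyticENN.const_mul {φ : X → ENNReal} (h : LowerSemianalyticENN φ)
    {a : ENNReal} (ha0 : a ≠ 0) (ha : a ≠ ⊤) : LowerSemianalyticENN fun x => a * φ x := by
  intro r
  simpa only [ENNReal.lt_div_iff_mul_lt (Or.inl ha0) (Or.inl ha), mul_comm] using h (r / a)

theorem LowerSemianalyticENN.add [T2Space X] {φ ψ : X → ENNReal} (hφ : LowerSemianalyticENN φ)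
    (hψ : LowerSemianalyticENN ψ) : LowerSemianalyticENN fun x => φ x + ψ x := by
  intro r
  have : {x | φ x + ψ x < r} = ⋃ q : ℚ, {x | φ x < ((Real.toNNReal q : NNReal) : ENNReal)} ∩
      {x | ψ x < r - ((Real.toNNReal q : NNReal) : ENNReal)} := by
    ext x
    simp only [mem_ofPred_eq, mem_iUnion, mem_inter_iff]
    constructor
    · intro h
      obtain ⟨q, -, hq1, hq2⟩ := ENNReal.lt_iff_exists_rat_btwn.1 (lt_tsub_iff_right.2 h)
      exact ⟨q, hq1, lt_tsub_iff_left.2 (lt_tsub_iff_right.1 hq2)⟩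
    · rintro ⟨q, hq1, hq2⟩
      exact (add_le_add_left hq1.le _).trans_lt (lt_tsub_iff_left.1 hq2)
  rw [this]
  exact AnalyticSet.iUnion fun q => (hφ _).inter (hψ _)

variable [SecondCountableTopology X] [MeasurableSpace X] [BorelSpace X] [StandardBorelSpace X]

theorem analyticSet_univ : AnalyticSet (univ : Set X) :=
  analyticSet_of_measurableSet MeasurableSet.univ

variable [T2Space X]

theorem LowerSemianalyticENN.analyticSet_le {φ : X → ENNReal} (h : LowerSemianalyticENN φ)
    (r : ENNReal) : AnalyticSet {x | φ x ≤ r} := by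
  by_cases hr : r = ⊤
  · simpa [hr] using analyticSet_univ
  obtain ⟨u, -, hu, hlim⟩ := exists_seq_strictAnti_tendsto' (lt_top_iff_ne_top.2 hr)
  have : {x | φ x ≤ r} = ⋂ n, {x | φ x < u n} := by
    ext x
    simp only [mem_ofPred_eq, mem_iInter]
    exact ⟨fun h n => h.trans_lt (hu n).1, fun h => ge_of_tendsto' hlim fun n => (h n).le⟩
  rw [this]
  exact AnalyticSet.iInter fun n => h _

theorem LowerSemianalyticENN.iSup {φ : ℕ → X → ENNReal} (h : ∀ n, LowerSemianalyticENN (φ n)) :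
    LowerSemianalyticENN fun x => ⨆ n, φ n x := by
  intro r
  by_cases hr : r = 0
  · simpa [hr] using analyticSet_empty
  obtain ⟨u, -, hu, hlim⟩ := exists_seq_strictMono_tendsto' (pos_iff_ne_zero.2 hr)
  have : {x | ⨆ n, φ n x < r} = ⋃ m, ⋂ n, {x | φ n x ≤ u m} := by
    ext x
    simp only [mem_ofPred_eq, mem_iUnion, mem_iInter]
    constructor
    · intro h
      obtain ⟨m, hm⟩ := (hlim.eventually (lt_mem_nhds h)).exists
      exact ⟨m, fun n => (le_iSup (fun n => φ n x) n).trans hm.le⟩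
    · rintro ⟨m, hm⟩
      exact (iSup_le hm).trans_lt (hu m).2
  rw [this]
  exact AnalyticSet.iUnion fun m => AnalyticSet.iInter fun n => (h n).analyticSet_le _

theorem LowerSemianalyticENN.tsum {φ : ℕ → X → ENNReal}
    (h : ∀ n, LowerSemianalyticENN (φ n)) : LowerSemianalyticENN fun x => ∑' n, φ n x := by
  simp only [ENNReal.tsum_eq_iSup_nat]
  refine LowerSemianalyticENN.iSup fun n => ?_
  induction n with
  | zero =>
    intro r
    simpa using (analyticSet_of_measurableSet (MeasurableSet.const (0 < r)))
  | succ n ih =>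
    simp only [Finset.sum_range_succ]
    exact ih.add (h n)

end Analytic

/-! ### Operations on lower semi-analytic functions -/

section LowerSemianalytic

variable {X : Type*} [TopologicalSpace X]

theorem LowerSemianalytic.analyticSet_lt {h : X → EReal} (hh : LowerSemianalytic h) (c : EReal) :
    AnalyticSet {x | h x < c} := by
  -- For real `c` this is the definition; the rational thresholds below `c` also cover `c = ±∞`.
  have : {x | h x < c} = ⋃ q : ℚ, ⋃ _ : ((q : ℝ) : EReal) < c, {x | h x < ((q : ℝ) : EReal)} := by
    ext x
    simp only [mem_ofPred_eq, mem_iUnion, exists_prop]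
    rw [EReal.lt_iff_exists_rat_btwn]
    exact exists_congr fun q => and_comm
  rw [this]
  exact AnalyticSet.iUnion fun q => analyticSet_iUnion_prop fun _ => hh _

/-- The convention `∞ - ∞ = ∞` is what makes this true: `a + b < c` holds if and only if `a < q` and
`b < c - q` for some rational `q`. -/
theorem LowerSemianalytic.addTop [T2Space X] {f h : X → EReal} (hf : LowerSemianalytic f)
    (hh : LowerSemianalytic h) : LowerSemianalytic fun x => addTop (f x) (h x) := by
  intro c
  have : {x | StochControl.addTop (f x) (h x) < c} = ⋃ q : ℚ, {x | f x < ((q : ℝ) : EReal)} ∩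
      {x | h x < ((c - q : ℝ) : EReal)} := by
    ext x
    simp only [mem_ofPred_eq, mem_iUnion, mem_inter_iff]
    generalize f x = a
    generalize h x = b
    constructor
    · intro hab
      unfold StochControl.addTop at hab
      split_ifs at hab with ht
      · simp at hab
      rw [not_or] at ht
      induction b with
      | top => exact absurd rfl ht.2
      | bot =>
        obtain ⟨q, hq, -⟩ := EReal.lt_iff_exists_rat_btwn.1 (lt_top_iff_ne_top.2 ht.1)
        exact ⟨q, hq, EReal.bot_lt_coe _⟩
      | coe b =>
        have h1 : a < ((c - b : ℝ) : EReal) := by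
          induction a with
          | top => exact absurd rfl ht.1
          | bot => exact EReal.bot_lt_coe _
          | coe a =>
            norm_cast at hab ⊢
            linarith
        obtain ⟨q, hq, hq'⟩ := EReal.lt_iff_exists_rat_btwn.1 h1
        refine ⟨q, hq, ?_⟩
        rw [EReal.coe_lt_coe_iff] at hq' ⊢
        linarith
    · rintro ⟨q, hq1, hq2⟩
      unfold StochControl.addTop
      rw [if_neg (by rw [not_or]; exact ⟨ne_top_of_lt hq1, ne_top_of_lt hq2⟩)]
      refine (EReal.add_lt_add hq1 hq2).trans_eq ?_
      norm_cast
      ring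
  rw [this]
  exact AnalyticSet.iUnion fun q => (hf _).inter (hh _)

theorem LowerSemianalytic.const_mul [SecondCountableTopology X] [MeasurableSpace X]
    [BorelSpace X] [StandardBorelSpace X] {h : X → EReal}
    (hh : LowerSemianalytic h) {a : ℝ} (ha : 0 ≤ a) :
    LowerSemianalytic fun x => (a : EReal) * h x := by
  intro c
  rcases ha.eq_or_lt with rfl | ha
  · simpa using analyticSet_of_measurableSet (MeasurableSet.const ((0 : EReal) < c))
  · have : ∀ b : EReal, (a : EReal) * b < c ↔ b < ((c / a : ℝ) : EReal) := by
      intro b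
      induction b with
      | top => simp [EReal.coe_mul_top_of_pos ha]
      | bot => simp [EReal.coe_mul_bot_of_pos ha]
      | coe b =>
        norm_cast
        rw [lt_div_iff₀ ha, mul_comm]
    simp only [this]
    exact hh _

/-- Only the values of `h` on `B` matter. -/
theorem LowerSemianalytic.indicator [SecondCountableTopology X] [MeasurableSpace X]
    [BorelSpace X] [StandardBorelSpace X] [T2Space X]
    {h : X → EReal} {B : Set X}
    (hh : ∀ c : ℝ, AnalyticSet (B ∩ {x | h x < c})) (hB : MeasurableSet B) :
    LowerSemianalytic (B.indicator h) := by
  intro c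
  have : {x | B.indicator h x < c} = (B ∩ {x | h x < c}) ∪ (Bᶜ ∩ {_x | (0 : EReal) < c}) := by
    ext x
    by_cases hx : x ∈ B <;> simp [hx]
  rw [this]
  exact (hh c).union (analyticSet_of_measurableSet (hB.compl.inter (MeasurableSet.const _)))

/-- A function on an analytic subset is lower semi-analytic if and only if its extension by `∞` is, so
that all computations can take place on the whole space. -/
theorem lowerSemianalyticOn_iff {D : Set X} {f : D → EReal}
    (hD : AnalyticSet D) : LowerSemianalyticOn D f ↔ LowerSemianalytic (extendTop f) := by
  have h : ∀ c : ℝ, {x : X | ∃ h : x ∈ D, f ⟨x, h⟩ < (c : EReal)} =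
      {x | extendTop f x < c} := by
    intro c
    ext x
    by_cases hx : x ∈ D <;> simp [extendTop, hx]
  simp only [LowerSemianalyticOn, LowerSemianalytic, h, hD, true_and]

end LowerSemianalytic

/-! ### Integration against kernels -/

section Integral

variable {X : Type*} [TopologicalSpace X] [T2Space X] [SecondCountableTopology X]
  [MeasurableSpace X] [BorelSpace X] [StandardBorelSpace X]
  {Y : Type*} [TopologicalSpace Y] [T2Space Y] [SecondCountableTopology Y]
  [MeasurableSpace Y] [BorelSpace Y] [StandardBorelSpace Y]
  (κ : Kernel X Y) [IsMarkovKernel κ]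

theorem UpperSemianalyticENN.lintegral_kernel {f : X × Y → ENNReal} (hf : UpperSemianalyticENN f) :
    UpperSemianalyticENN fun x => lintegral (κ x).completion fun y => f (x, y) := by
  have hnull : ∀ x t, NullMeasurableSet {y | t < f (x, y)} (κ x) := fun x t =>
    ((hf t).preimage_of_continuous (f := Prod.mk x) (by fun_prop)).nullMeasurableSet _
  refine (congrArg UpperSemianalyticENN
    (funext fun x => lintegral_completion_eq_iSup_tsum (κ x) (hnull x))).mpr ?_
  refine UpperSemianalyticENN.iSup fun n => ?_
  refine UpperSemianalyticENN.const_mul ?_ (by simp) (by simp)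
  exact UpperSemianalyticENN.tsum fun k => analyticSet_lt_kernel κ (hf _)

theorem LowerSemianalyticENN.lintegral_kernel {f : X × Y → ENNReal}
    (hf : LowerSemianalyticENN f) :
    LowerSemianalyticENN fun x => lintegral (κ x).completion fun y => f (x, y) := by
  have hcompl : ∀ x t, {y | t < f (x, y)} = (Prod.mk x ⁻¹' {z | f z ≤ t})ᶜ := by
    intro x t
    ext y
    simp
  have hnull : ∀ x t, NullMeasurableSet (Prod.mk x ⁻¹' {z | f z ≤ t}) (κ x) := fun x t =>
    ((hf.analyticSet_le t).preimage_of_continuous (by fun_prop)).nullMeasurableSet _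
  refine (congrArg LowerSemianalyticENN
    (funext fun x => lintegral_completion_eq_iSup_tsum (κ x) (f := fun y => f (x, y))
      (fun t => by rw [hcompl]; exact (hnull x t).compl))).mpr ?_
  refine LowerSemianalyticENN.iSup fun n => ?_
  refine LowerSemianalyticENN.const_mul ?_ (by simp) (by simp)
  refine LowerSemianalyticENN.tsum fun k r => ?_
  simp only [hcompl, prob_compl_eq_one_sub₀ (hnull _ _)]
  by_cases hr : r ≤ 1
  · have : ∀ p : ENNReal, p ≤ 1 → (1 - p < r ↔ 1 - r < p) := by
      intro p hp
      rw [ENNReal.sub_lt_iff_lt_right (ne_top_of_le_ne_top ENNReal.one_ne_top hp) hp,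
        ENNReal.sub_lt_iff_lt_right (ne_top_of_le_ne_top ENNReal.one_ne_top hr) hr, add_comm]
    simp only [fun x => this _ (prob_le_one (μ := κ x)
      (s := Prod.mk x ⁻¹' {z | f z ≤ ((k : ENNReal) + 1) / ((n + 1 : ℕ) : ENNReal)}))]
    exact analyticSet_lt_kernel κ (hf.analyticSet_le _) _
  · have : ∀ p : ENNReal, 1 - p < r := fun p => tsub_le_self.trans_lt (not_le.1 hr)
    simpa [this] using analyticSet_univ

theorem LowerSemianalytic.eIntegral_kernel {f : X × Y → EReal} (hf : LowerSemianalytic f) :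
    LowerSemianalytic fun x => eIntegral (κ x) fun y => f (x, y) := by
  have hpos : LowerSemianalyticENN fun z => (f z).toENNReal := by
    intro r
    by_cases hr : r = 0
    · simpa [hr] using analyticSet_empty
    have : ∀ b : EReal, b.toENNReal < r ↔ b < (r : EReal) := by
      intro b
      rcases le_total 0 b with hb | hb
      · rw [← EReal.coe_ennreal_lt_coe_ennreal_iff, EReal.coe_toENNReal hb]
      · rw [EReal.toENNReal_of_nonpos hb]
        have hr' : (0 : EReal) < r := by simpa using pos_iff_ne_zero.2 hr
        exact iff_of_true (pos_iff_ne_zero.2 hr) (hb.trans_lt hr')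
    simp only [this]
    exact hf.analyticSet_lt _
  have hneg : UpperSemianalyticENN fun z => (-f z).toENNReal := by
    intro r
    have : ∀ b : EReal, r < (-b).toENNReal ↔ b < -(r : EReal) := by
      intro b
      rw [EReal.lt_neg_comm]
      rcases le_total 0 (-b) with hb | hb
      · rw [← EReal.coe_ennreal_lt_coe_ennreal_iff, EReal.coe_toENNReal hb]
      · rw [EReal.toENNReal_of_nonpos hb]
        exact iff_of_false not_lt_zero (not_lt.2 (hb.trans (EReal.coe_ennreal_nonneg r)))
    simp only [this]
    exact hf.analyticSet_lt _
  refine LowerSemianalytic.addTop ?_ ?_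
  · intro c
    have h := hpos.lintegral_kernel κ (ENNReal.ofReal c)
    have : ∀ b : ENNReal, (b : EReal) < c ↔ b < ENNReal.ofReal c := by
      intro b
      rcases le_or_gt c 0 with hc | hc
      · rw [ENNReal.ofReal_of_nonpos hc]
        refine iff_of_false (not_lt.2 ?_) not_lt_zero
        exact (EReal.coe_le_coe_iff.2 hc).trans (EReal.coe_ennreal_nonneg b)
      · rw [← EReal.coe_ennreal_lt_coe_ennreal_iff, EReal.coe_ennreal_ofReal, max_eq_left hc.le]
    simpa only [this] using h
  · intro c
    rcases lt_or_ge 0 c with hc | hc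
    · have : ∀ b : ENNReal, -(b : EReal) < c := fun b =>
        lt_of_le_of_lt (EReal.neg_le.2 (by simpa using EReal.coe_ennreal_nonneg b))
          (EReal.coe_pos.2 hc)
      exact (congrArg AnalyticSet (eq_univ_of_forall fun x => this _)).mpr analyticSet_univ
    · have h := hneg.lintegral_kernel κ (ENNReal.ofReal (-c))
      have : ∀ b : ENNReal, -(b : EReal) < c ↔ ENNReal.ofReal (-c) < b := by
        intro b
        rw [EReal.neg_lt_comm, ← EReal.coe_ennreal_lt_coe_ennreal_iff, EReal.coe_ennreal_ofReal,
          max_eq_left (by linarith)]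
        simp
      simpa only [this] using h

end Integral

/-! ### Borel measurability outside a null set -/

/-- A family of probability measures that depends on a parameter in a `p`-measurable way is Borel
measurable on a Borel set of full `p`-measure. -/
theorem exists_measurableSet_measurable_restrict {S C : Type*} [MeasurableSpace S]
    [MeasurableSpace C] [MeasurableSpace.CountablyGenerated C] (κ : S → Measure C)
    [∀ x, IsProbabilityMeasure (κ x)] (p : Measure S)
    (hκ : ∀ D, MeasurableSet D → NullMeasurable (fun x => κ x D) p) :
    ∃ B, MeasurableSet B ∧ p Bᶜ = 0 ∧ Measurable fun x : B => κ x := by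
  let 𝒜 := generateSetAlgebra (MeasurableSpace.countableGeneratingSet C)
  have h𝒜c : 𝒜.Countable :=
    countable_generateSetAlgebra (MeasurableSpace.countable_countableGeneratingSet)
  have h𝒜g : ‹MeasurableSpace C› = MeasurableSpace.generateFrom 𝒜 := by
    rw [generateFrom_generateSetAlgebra_eq, MeasurableSpace.generateFrom_countableGeneratingSet]
  have h𝒜m : ∀ D ∈ 𝒜, MeasurableSet D := fun D hD => by
    rw [h𝒜g]
    exact MeasurableSpace.measurableSet_generateFrom hD
  have := h𝒜c.to_subtype
  have hae : ∀ D : 𝒜, AEMeasurable (fun x => κ x D) p := fun D =>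
    (hκ D (h𝒜m D D.2)).aemeasurable
  have hall : ∀ᵐ x ∂p, ∀ D : 𝒜, κ x D = (hae D).mk _ x := ae_all_iff.2 fun D => (hae D).ae_eq_mk
  refine ⟨(toMeasurable p {x | ∀ D : 𝒜, κ x D = (hae D).mk _ x}ᶜ)ᶜ,
    (measurableSet_toMeasurable _ _).compl, ?_, ?_⟩
  · rw [compl_compl, measure_toMeasurable]
    exact hall
  · have : ∀ x : ((toMeasurable p {x | ∀ D : 𝒜, κ x D = (hae D).mk _ x}ᶜ)ᶜ : Set S),
        IsProbabilityMeasure (κ x) := fun x => inferInstance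
    refine Measurable.measure_of_isPiSystem_of_isProbabilityMeasure h𝒜g
      (isSetAlgebra_generateSetAlgebra.isSetRing.isSetSemiring.isPiSystem) ?_
    intro D hD
    have hx : ∀ x : ((toMeasurable p {x | ∀ D : 𝒜, κ x D = (hae D).mk _ x}ᶜ)ᶜ : Set S),
        κ x D = (hae ⟨D, hD⟩).mk _ x := fun x => by
      have := compl_subset_compl.2 (subset_toMeasurable p _) x.2
      rw [compl_compl] at this
      exact this ⟨D, hD⟩
    simp only [hx]
    exact (hae ⟨D, hD⟩).measurable_mk.comp measurable_subtype_coe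

end StochControl

open StochControl in
theorem proposition3p1 {S : Type*} {C : Type*}
    [TopologicalSpace S] [TopologicalSpace.MetrizableSpace S] [SecondCountableTopology S]
    [MeasurableSpace S] [BorelSpace S] [StandardBorelSpace S]
    [TopologicalSpace C] [TopologicalSpace.MetrizableSpace C] [SecondCountableTopology C]
    [MeasurableSpace C] [BorelSpace C] [StandardBorelSpace C]
    (M : StochControl.ControlModel S C) :
    (∀ θ ∈ StochControl.Theta M, ∀ J : S → EReal, StochControl.LowerSemianalytic J →
      ∀ Q : M.Γ → EReal, StochControl.LowerSemianalyticOn M.Γ Q →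
        StochControl.LowerSemianalyticOn M.Γ (StochControl.F M θ Q J)) ∧
    (∀ μ : StochControl.StationaryPolicy M, ∀ p : MeasureTheory.Measure S,
      MeasureTheory.IsProbabilityMeasure p →
        ∃ B : Set S, p Bᶜ = 0 ∧ (μ, B) ∈ StochControl.Theta M) := by
  refine ⟨?_, ?_⟩
  · rintro ⟨μ, B⟩ ⟨hB, hμ⟩ J hJ Q hQ
    dsimp only at hB hμ
    have hΓ : AnalyticSet M.Γ := M.analytic_graph
    rw [lowerSemianalyticOn_iff hΓ] at hQ ⊢
    have hg : LowerSemianalytic (extendTop (D := M.Γ) M.g) :=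
      (lowerSemianalyticOn_iff hΓ).1 M.g_lsa
    have := M.q_prob
    have : IsMarkovKernel M.q := ⟨M.q_prob⟩
    have hq : ∀ f : S → EReal, LowerSemianalytic f →
        LowerSemianalytic fun z : S × C => (M.α : EReal) * eIntegral (M.q z) f := fun f hf =>
      (LowerSemianalytic.eIntegral_kernel (f := fun w : (S × C) × S => f w.2) M.q
        fun c => (hf c).preimage_of_continuous continuous_snd).const_mul M.α_nonneg
    have hmin : LowerSemianalytic fun w : S × C => min (J w.1) (extendTop Q w) := by
      intro c
      simp only [min_lt_iff]
      exact ((hJ c).preimage_of_continuous continuous_fst).union (hQ c)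
    have h1 : LowerSemianalytic (indicator Bᶜ J) :=
      .indicator (fun c => (analyticSet_of_measurableSet hB.compl).inter (hJ c)) hB.compl
    have h2 : LowerSemianalytic (indicator B fun x' => eIntegral (μ.toFun x') fun u' =>
        min (J x') (extendTop Q (x', u'))) := by
      refine .indicator (fun c => ?_) hB
      obtain rfl | ⟨x₀, hx₀⟩ := B.eq_empty_or_nonempty
      · simpa using analyticSet_empty
      classical
      -- Off `B` the policy may fail to be Borel; a Borel kernel that agrees with it on `B` suffices.
      let κ₁ : Kernel S C := ⟨fun x => if x ∈ B then μ.toFun x else μ.toFun x₀, by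
        refine Measure.measurable_of_measurable_coe _ fun D hD => ?_
        refine measurable_of_restrict_of_restrict_compl hB ?_ ?_
        · convert! hμ D hD using 2 with x
          exact congrArg (fun m : Measure C => m D) (if_pos x.2)
        · convert! measurable_const (a := μ.toFun x₀ D) using 2 with x
          exact congrArg (fun m : Measure C => m D) (if_neg x.2)⟩
      have hκ : IsMarkovKernel κ₁ := ⟨fun x => by
        change IsProbabilityMeasure (if x ∈ B then μ.toFun x else μ.toFun x₀)
        split_ifs
        exacts [μ.prob x, μ.prob x₀]⟩
      have hκB : ∀ x ∈ B, κ₁ x = μ.toFun x := fun x hx => if_pos hx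
      have h := (analyticSet_of_measurableSet hB).inter (hmin.eIntegral_kernel κ₁ c)
      convert! h using 1
      ext x
      refine and_congr_right fun hx => ?_
      simp only [mem_ofPred_eq]
      rw [hκB x hx]
    convert! (hg.addTop (hq _ h1)).addTop (hq _ h2) using 1
    funext z
    by_cases hz : z ∈ M.Γ
    · simp [extendTop, hz, F]
    · simp [extendTop, hz, addTop]
  · intro μ p hp
    have := μ.prob
    obtain ⟨B, hB, hpB, hμB⟩ := exists_measurableSet_measurable_restrict μ.toFun p
      fun D hD t ht => μ.univ_meas D hD ht p hp
    exact ⟨B, hpB, hB, fun D hD => (Measure.measurable_coe hD).comp hμB⟩
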